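/- Let $\mathbb{K}$ be a field, let $\mathsf{Ch}_{\mathbb K}$ be the category of (unbounded) differential graded $\mathbb{K}$-modules with differential of degree $+1$, and call the objects of $\mathsf{Ch}_{\mathbb K}^{(\mathbb{R},\le)}$ persistence dg modules. For a category $\mathcal{C}$, an object $F$ of $\mathcal{C}^{(\mathbb{R},\le)}$ and $\varepsilon\ge 0$, let $F^\varepsilon(a)=F(a+\varepsilon)$. Objects $F,G$ of $\mathcal{C}^{(\mathbb{R},\le)}$ are $\varepsilon$-interleaved if there are morphisms $\varphi:F\to G^\varepsilon$ and $\psi:G\to F^\varepsilon$ such that $\psi^\varepsilon\circ\varphi$ and $\varphi^\varepsilon\circ\psi$ are the structure morphisms $F\to F^{2\varepsilon}$ and $G\to G^{2\varepsilon}$; the interleaving distance is $d_{\mathrm I}(F,G)=\inf(\{\varepsilon\ge 0\mid F,G \text{ are } \varepsilon\text{-interleaved}\}\cup\{\infty\})$. A weak equivalence in $\mathsf{Ch}_{\mathbb K}$ is a quasi-isomorphism, a weak equivalence in $\mathsf{Ch}_{\mathbb K}^{(\mathbb{R},\le)}$ is an objectwise one, and $\mathrm{Ho}$ denotes localization at the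 weak equivalences. Let $X,Y$ be persistence dg modules. - $X,Y$ are $\varepsilon$-homotopy commutative interleaved if their images in $\mathrm{Ho}(\mathsf{Ch}_{\mathbb K})^{(\mathbb{R},\le)}$ are $\varepsilon$-interleaved. - $X,Y$ are $\varepsilon$-interleaved in the homotopy category if there are morphisms $\varphi:X\to Y^\varepsilon$, $\psi:Y\to X^\varepsilon$ in $\mathrm{Ho}(\mathsf{Ch}_{\mathbb K}^{(\mathbb{R},\le)})$ such that, for the functor $(\ )^\varepsilon$ induced on $\mathrm{Ho}(\mathsf{Ch}_{\mathbb K}^{(\mathbb{R},\le)})$, $\psi^\varepsilon\circ\varphi$ and $\varphi^\varepsilon\circ\psi$ are the images of the structure morphisms $X\to X^{2\varepsilon}$ and $Y\to Y^{2\varepsilon}$. - $X,Y$ are $\varepsilon$-homotopy interleaved if there are persistence dg modules $X',Y'$, connected to $X$ and $Y$ respectively by zigzags of weak equivalences, that are $\varepsilon$-interleaved in $\mathsf{Ch}_{\mathbb K}^{(\mathbb{R},\le)}$. Let $d_{\mathrm{HC}}(X,Y)$, $d_{\mathrm{IHC}}(X,Y)$ and $d_{\mathrm{HI}}(X,Y)$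 be the infima in $[0,\infty]$ of the $\varepsilon\ge0$ for which $X,Y$ are interleaved in the first, second and third sense respectively ($\infty$ if there are none). Let $d_{\mathrm{CohI}}(X,Y)=\sup_{k\in\mathbb{Z}} d_{\mathrm I}(H^k(X),H^k(Y))$, where $H^k(X)$ is the persistence vector space $a\mapsto H^k(X(a))$. Theorem. For all persistence dg modules $X$ and $Y$ over $\mathbb{K}$, $$d_{\mathrm{HC}}(X,Y)=d_{\mathrm{IHC}}(X,Y)=d_{\mathrm{HI}}(X,Y)=d_{\mathrm{CohI}}(X,Y).$$ -/

import Mathlib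

universe v u

open CategoryTheory
open scoped NNReal ENNReal

noncomputable section

namespace Persistence

/-! ### Interleavings of functors on the poset of real numbers -/

/-- The functor `T_ε : (ℝ, ≤) ⥤ (ℝ, ≤)`, `a ↦ a + ε`. -/
def translation (ε : ℝ≥0) : ℝ ⥤ ℝ :=
  Monotone.functor (f := fun a : ℝ => a + (ε : ℝ)) (fun _ _ h => by simpa using h)

section General

variable (C : Type u) [Category.{v} C]

/-- The shift functor `F ↦ F^ε = F ∘ T_ε` on persistence objects of `C`. -/
def shift (ε : ℝ≥0) : (ℝ ⥤ C) ⥤ (ℝ ⥤ C) :=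
  (Functor.whiskeringLeft ℝ ℝ C).obj (translation ε)

/-- The natural transformation `F ⟶ F^{2ε} = (F^ε)^ε`, which at `a : ℝ` is the structure map
`F(a ≤ a + ε + ε)`. -/
def structureMap (ε : ℝ≥0) : 𝟭 (ℝ ⥤ C) ⟶ shift C ε ⋙ shift C ε where
  app F :=
    { app := fun a => F.map (homOfLE (by
        change a ≤ a + (ε : ℝ) + (ε : ℝ)
        have := ε.coe_nonneg
        linarith))
      naturality := fun a b f => by
        change F.map f ≫ F.map _ = F.map _ ≫ F.map _
        rw [← F.map_comp, ← F.map_comp]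
        rfl }
  naturality F G α := by
    ext a
    exact (α.naturality _).symm

variable {C}

/-- `F` and `G` are `ε`-interleaved: there are `φ : F ⟶ G^ε` and `ψ : G ⟶ F^ε` such that
`ψ^ε ∘ φ` and `φ^ε ∘ ψ` are the structure maps `F ⟶ F^{2ε}` and `G ⟶ G^{2ε}`. -/
def Interleaved (ε : ℝ≥0) (F G : ℝ ⥤ C) : Prop :=
  ∃ (φ : F ⟶ (shift C ε).obj G) (ψ : G ⟶ (shift C ε).obj F),
    φ ≫ (shift C ε).map ψ = (structureMap C ε).app F ∧
    ψ ≫ (shift C ε).map φ = (structureMap C ε).app G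

end General

/-- The infimum in `[0, ∞]` of the set of all `ε ≥ 0` with `P ε`, together with `∞`. -/
def infDist (P : ℝ≥0 → Prop) : ℝ≥0∞ :=
  sInf ({d : ℝ≥0∞ | ∃ ε : ℝ≥0, P ε ∧ d = ε} ∪ {⊤})

/-- The interleaving distance `d_I`. -/
def interleavingDist {C : Type u} [Category.{v} C] (F G : ℝ ⥤ C) : ℝ≥0∞ :=
  infDist fun ε => Interleaved ε F G

/-! ### Interleavings up to homotopy

The constructions depend only on a category `M` and its class `W` of weak equivalences. The
homotopy category of `M` is the localization `W.Localization`. The weak equivalences between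
persistence objects of `M` (those of the projective model structure) are the natural
transformations that are objectwise in `W`. -/

section UpToHomotopy

variable {M : Type u} [Category.{v} M] (W : MorphismProperty M)

/-- The class of objectwise weak equivalences of persistence objects. -/
abbrev weakEquiv : MorphismProperty (ℝ ⥤ M) := W.functorCategory ℝ

/-- `X ≃ Y`: there is a finite zigzag of objectwise weak equivalences between `X` and `Y`. -/
def WeaklyEquivalent (X Y : ℝ ⥤ M) : Prop :=
  Relation.EqvGen (fun A B : ℝ ⥤ M => ∃ f : A ⟶ B, weakEquiv W f) X Y

/-- `X` and `Y` are `ε`-homotopy interleaved. -/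
def HomotopyInterleaved (ε : ℝ≥0) (X Y : ℝ ⥤ M) : Prop :=
  ∃ X' Y' : ℝ ⥤ M, WeaklyEquivalent W X X' ∧ WeaklyEquivalent W Y Y' ∧ Interleaved ε X' Y'

/-- `X` and `Y` are `ε`-homotopy commutative interleaved: their images in `Ho(M)^(ℝ, ≤)` are
`ε`-interleaved. -/
def HomotopyCommutativeInterleaved (ε : ℝ≥0) (X Y : ℝ ⥤ M) : Prop :=
  Interleaved ε (X ⋙ W.Q) (Y ⋙ W.Q)

theorem shift_inverts (ε : ℝ≥0) :
    (weakEquiv W).IsInvertedBy (shift M ε ⋙ (weakEquiv W).Q) := fun _ _ f hf =>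
  (weakEquiv W).Q_inverts ((shift M ε).map f) (fun a => hf ((translation ε).obj a))

/-- The functor induced on `Ho(M^(ℝ, ≤))` by the shift functor, which preserves weak
equivalences. -/
def hoShift (ε : ℝ≥0) : (weakEquiv W).Localization ⥤ (weakEquiv W).Localization :=
  Localization.lift (shift M ε ⋙ (weakEquiv W).Q) (shift_inverts W ε) (weakEquiv W).Q

/-- The canonical isomorphism between the shift in `Ho(M^(ℝ, ≤))` of the image of `X`, and the
image of the shift of `X`. -/
def hoShiftIso (ε : ℝ≥0) :
    (weakEquiv W).Q ⋙ hoShift W ε ≅ shift M ε ⋙ (weakEquiv W).Q :=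
  Localization.fac (shift M ε ⋙ (weakEquiv W).Q) (shift_inverts W ε) (weakEquiv W).Q

/-- The structure map `X ⟶ X^{2ε}` in `Ho(M^(ℝ, ≤))`. -/
def hoStructureMap (ε : ℝ≥0) (X : ℝ ⥤ M) :
    (weakEquiv W).Q.obj X ⟶ (hoShift W ε).obj ((hoShift W ε).obj ((weakEquiv W).Q.obj X)) :=
  (weakEquiv W).Q.map ((structureMap M ε).app X) ≫
    (hoShiftIso W ε).inv.app ((shift M ε).obj X) ≫
    (hoShift W ε).map ((hoShiftIso W ε).inv.app X)

/-- `X` and `Y` are `ε`-interleaved in the homotopy category `Ho(M^(ℝ, ≤))`. -/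
def InterleavedInHo (ε : ℝ≥0) (X Y : ℝ ⥤ M) : Prop :=
  ∃ (φ : (weakEquiv W).Q.obj X ⟶ (hoShift W ε).obj ((weakEquiv W).Q.obj Y))
    (ψ : (weakEquiv W).Q.obj Y ⟶ (hoShift W ε).obj ((weakEquiv W).Q.obj X)),
    φ ≫ (hoShift W ε).map ψ = hoStructureMap W ε X ∧
    ψ ≫ (hoShift W ε).map φ = hoStructureMap W ε Y

end UpToHomotopy

/-! ### Persistence dg modules -/

section DG

variable (K : Type u) [Field K]

/-- The category of dg modules over `K`: unbounded complexes with differential of degree `+1`. -/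
abbrev DGMod : Type (u + 1) := CochainComplex (ModuleCat.{u} K) ℤ

/-- Persistence dg modules over `K`, indexed by `(ℝ, ≤)`. -/
abbrev PersistenceDGMod : Type (u + 1) := ℝ ⥤ DGMod K

/-- The weak equivalences of dg modules: the quasi-isomorphisms. -/
abbrev qis : MorphismProperty (DGMod K) :=
  HomologicalComplex.quasiIso (ModuleCat.{u} K) (ComplexShape.up ℤ)

variable {K}

/-- The persistence vector space `a ↦ H^k(X(a))`. -/
abbrev cohomology (k : ℤ) (X : PersistenceDGMod K) : ℝ ⥤ ModuleCat.{u} K :=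
  X ⋙ HomologicalComplex.homologyFunctor (ModuleCat.{u} K) (ComplexShape.up ℤ) k

/-- The homotopy commutative interleaving distance. -/
def dHC (X Y : PersistenceDGMod K) : ℝ≥0∞ :=
  infDist fun ε => HomotopyCommutativeInterleaved (qis K) ε X Y

/-- The interleaving distance in the homotopy category. -/
def dIHC (X Y : PersistenceDGMod K) : ℝ≥0∞ :=
  infDist fun ε => InterleavedInHo (qis K) ε X Y

/-- The homotopy interleaving distance. -/
def dHI (X Y : PersistenceDGMod K) : ℝ≥0∞ :=
  infDist fun ε => HomotopyInterleaved (qis K) ε X Y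

/-- The cohomology interleaving distance. -/
def dCohI (X Y : PersistenceDGMod K) : ℝ≥0∞ :=
  ⨆ k : ℤ, interleavingDist (cohomology k X) (cohomology k Y)

end DG

end Persistence

end

/-!
The distances are compared along the chain `d_CohI ≤ d_HC ≤ d_IHC ≤ d_HI ≤ d_CohI`. The first three
inequalities hold because, for each `ε`, each notion of interleaving implies the preceding one. A
zigzag of weak equivalences becomes an isomorphism in `Ho(Ch^(ℝ, ≤))`, the comparison functor
`Ho(Ch^(ℝ, ≤)) ⥤ Ho(Ch)^(ℝ, ≤)` commutes with shifts
(`InterleavedInHo.homotopyCommutativeInterleaved`), and cohomology factors through `Ho(Ch)`.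

For `d_HI ≤ d_CohI` the point is that, up to arbitrarily small homotopy interleavings, a persistence
dg module `X` is its cohomology with zero differential (`spanInterleaved_cohomologyComplex`).
The category of persistence vector spaces over `ℝ` is not hereditary, so `X` itself need not be
formal, but its restriction to a grid `δℤ` is. Persistence vector spaces over `ℤ` have free
resolutions `0 → P₁ → P₀ → H → 0` of length one (`shortExact_freeResolution`). Given such
resolutions of all the cohomology objects of a complex `D`, projectivity produces a morphism to `D`
from the mapping cone of `P₁ → P₀` (with zero differentials), and both this morphism and the
projection of the cone to the cohomology are quasi-isomorphisms (`exists_span_homology`).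
Rounding down to the grid moves any persistence object by at most `δ`
(`interleaved_discretization`).

These approximations are then composed with the interleavings of the cohomologies of `X` and `Y`,
which assemble, one degree at a time, into an interleaving of complexes with zero differential. This
requires the triangle inequality for homotopy interleavings. It is proved with spans of
trivial fibrations in place of zigzags (`SpanInterleaved.trans`): an interleaving pulls back along a
trivial fibration onto one of its two objects (`Interleaved.exists_pullback`), so that two
interleavings can be given the same middle object.
-/

noncomputable section

namespace Persistence

/-! ### Calculus of interleavings -/

section General

variable {C : Type u} [Category.{v} C]

lemma Interleaved.of_components {ε : ℝ≥0} {F G : ℝ ⥤ C}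
    (φ : ∀ a : ℝ, F.obj a ⟶ G.obj (a + ε)) (ψ : ∀ a : ℝ, G.obj a ⟶ F.obj (a + ε))
    (hφ : ∀ (a b : ℝ) (h : a ≤ b), F.map (homOfLE h) ≫ φ b =
      φ a ≫ G.map (homOfLE (add_le_add_left h (ε : ℝ))))
    (hψ : ∀ (a b : ℝ) (h : a ≤ b), G.map (homOfLE h) ≫ ψ b =
      ψ a ≫ F.map (homOfLE (add_le_add_left h (ε : ℝ))))
    (hφψ : ∀ (a : ℝ) (h : a ≤ a + ε + ε), φ a ≫ ψ (a + ε) = F.map (homOfLE h))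
    (hψφ : ∀ (a : ℝ) (h : a ≤ a + ε + ε), ψ a ≫ φ (a + ε) = G.map (homOfLE h)) :
    Interleaved ε F G :=
  ⟨{ app := φ, naturality := fun a b f => hφ a b (leOfHom f) },
   { app := ψ, naturality := fun a b f => hψ a b (leOfHom f) },
   by ext a; exact hφψ a _, by ext a; exact hψφ a _⟩

lemma Interleaved.exists_components {ε : ℝ≥0} {F G : ℝ ⥤ C} (h : Interleaved ε F G) :
    ∃ (φ : ∀ a : ℝ, F.obj a ⟶ G.obj (a + ε)) (ψ : ∀ a : ℝ, G.obj a ⟶ F.obj (a + ε)),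
    (∀ (a b : ℝ) (h : a ≤ b), F.map (homOfLE h) ≫ φ b =
      φ a ≫ G.map (homOfLE (add_le_add_left h (ε : ℝ)))) ∧
    (∀ (a b : ℝ) (h : a ≤ b), G.map (homOfLE h) ≫ ψ b =
      ψ a ≫ F.map (homOfLE (add_le_add_left h (ε : ℝ)))) ∧
    (∀ (a : ℝ) (h : a ≤ a + ε + ε), φ a ≫ ψ (a + ε) = F.map (homOfLE h)) ∧
    (∀ (a : ℝ) (h : a ≤ a + ε + ε), ψ a ≫ φ (a + ε) = G.map (homOfLE h)) := by
  obtain ⟨φ, ψ, h₁, h₂⟩ := h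
  exact ⟨φ.app, ψ.app, fun a b h => φ.naturality (homOfLE h), fun a b h => ψ.naturality (homOfLE h),
    fun a _ => congr_app h₁ a, fun a _ => congr_app h₂ a⟩

lemma Interleaved.symm {ε : ℝ≥0} {F G : ℝ ⥤ C} (h : Interleaved ε F G) : Interleaved ε G F := by
  obtain ⟨φ, ψ, h₁, h₂⟩ := h
  exact ⟨ψ, φ, h₂, h₁⟩

lemma Interleaved.map {D : Type*} [Category* D] (L : C ⥤ D) {ε : ℝ≥0} {F G : ℝ ⥤ C}
    (h : Interleaved ε F G) : Interleaved ε (F ⋙ L) (G ⋙ L) := by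
  obtain ⟨φ, ψ, hφ, hψ, h₁, h₂⟩ := h.exists_components
  refine .of_components (fun a => L.map (φ a)) (fun a => L.map (ψ a)) ?_ ?_ ?_ ?_
  · intro a b h; simpa using congr_arg L.map (hφ a b h)
  · intro a b h; simpa using congr_arg L.map (hψ a b h)
  · intro a h; simpa using congr_arg L.map (h₁ a h)
  · intro a h; simpa using congr_arg L.map (h₂ a h)

lemma Interleaved.of_iso {ε : ℝ≥0} {F F' G G' : ℝ ⥤ C} (h : Interleaved ε F G)
    (e : F ≅ F') (e' : G ≅ G') : Interleaved ε F' G' := by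
  obtain ⟨φ, ψ, h₁, h₂⟩ := h
  refine ⟨e.inv ≫ φ ≫ (shift C ε).map e'.hom, e'.inv ≫ ψ ≫ (shift C ε).map e.hom, ?_, ?_⟩
  · have := (structureMap C ε).naturality e.hom
    simp only [Functor.id_map, Functor.comp_map] at this
    simp only [Category.assoc, Functor.map_comp, Iso.map_hom_inv_id_assoc, reassoc_of% h₁,
      Iso.inv_comp_eq]
    exact this.symm
  · have := (structureMap C ε).naturality e'.hom
    simp only [Functor.id_map, Functor.comp_map] at this
    simp only [Category.assoc, Functor.map_comp, Iso.map_hom_inv_id_assoc, reassoc_of% h₂,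
      Iso.inv_comp_eq]
    exact this.symm

/-- The composition of an `ε`-interleaving and a `δ`-interleaving. The structure maps compare
`H(a + ε + δ)` with `H(a + (ε + δ))`, which are not definitionally equal. -/
lemma Interleaved.trans {ε δ : ℝ≥0} {F G H : ℝ ⥤ C} (h : Interleaved ε F G)
    (h' : Interleaved δ G H) : Interleaved (ε + δ) F H := by
  obtain ⟨φ, ψ, hφ, hψ, h₁, h₂⟩ := h.exists_components
  obtain ⟨φ', ψ', hφ', hψ', h₁', h₂'⟩ := h'.exists_components
  have hε := ε.coe_nonneg
  have hδ := δ.coe_nonneg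
  refine .of_components
    (fun a => φ a ≫ φ' (a + ε) ≫ H.map (homOfLE (by push_cast; linarith)))
    (fun a => ψ' a ≫ ψ (a + δ) ≫ F.map (homOfLE (by push_cast; linarith))) ?_ ?_ ?_ ?_
  · intro a b h
    rw [reassoc_of% hφ a b h, reassoc_of% hφ' (a + ε) (b + ε) (by linarith)]
    simp only [Category.assoc, ← Functor.map_comp, homOfLE_comp]
  · intro a b h
    rw [reassoc_of% hψ' a b h, reassoc_of% hψ (a + δ) (b + δ) (by linarith)]
    simp only [Category.assoc, ← Functor.map_comp, homOfLE_comp]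
  · intro a h
    simp only [Category.assoc]
    rw [reassoc_of% hψ' (a + ε + δ) (a + (ε + δ : ℝ≥0)) (by push_cast; linarith),
      reassoc_of% h₁' (a + ε) (by linarith),
      reassoc_of% hψ (a + ε + δ + δ) (a + (ε + δ : ℝ≥0) + δ) (by push_cast; linarith),
      reassoc_of% hψ (a + ε) (a + ε + δ + δ) (by linarith), reassoc_of% h₁ a (by linarith)]
    simp only [← Functor.map_comp, homOfLE_comp]
  · intro a h
    simp only [Category.assoc]
    rw [reassoc_of% hφ (a + δ + ε) (a + (ε + δ : ℝ≥0)) (by push_cast; linarith),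
      reassoc_of% h₂ (a + δ) (by linarith),
      reassoc_of% hφ' (a + δ + ε + ε) (a + (ε + δ : ℝ≥0) + ε) (by push_cast; linarith),
      reassoc_of% hφ' (a + δ) (a + δ + ε + ε) (by linarith), reassoc_of% h₂' a (by linarith)]
    simp only [← Functor.map_comp, homOfLE_comp]

/-- Reparametrizing along a monotone map that moves points down by at most `δ` gives a
`δ`-interleaved object. -/
lemma interleaved_comp_left (F : ℝ ⥤ C) (r : ℝ ⥤ ℝ) (δ : ℝ≥0) (hr : ∀ a, r.obj a ≤ a)
    (hr' : ∀ a, a ≤ r.obj a + δ) : Interleaved δ (r ⋙ F) F := by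
  have hδ := δ.coe_nonneg
  refine .of_components (fun a => F.map (homOfLE ((hr a).trans (by linarith))))
    (fun a => F.map (homOfLE (by have := hr' (a + δ); linarith))) ?_ ?_ ?_ ?_
  all_goals
    intros
    simp only [Functor.comp_map, ← Functor.map_comp]
    rfl

lemma Interleaved.mono {ε ε' : ℝ≥0} (hε : ε ≤ ε') {F G : ℝ ⥤ C} (h : Interleaved ε F G) :
    Interleaved ε' F G := by
  obtain ⟨δ, rfl⟩ := exists_add_of_le hε
  exact h.trans (interleaved_comp_left G (𝟭 ℝ) δ (fun _ => le_rfl) (fun a => by simp))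

end General

lemma infDist_mono {P P' : ℝ≥0 → Prop} (h : ∀ ε, P' ε → P ε) : infDist P ≤ infDist P' :=
  sInf_le_sInf (Set.union_subset_union_left _ fun _ ⟨ε, hε, hd⟩ => ⟨ε, h ε hε, hd⟩)

lemma infDist_le {P : ℝ≥0 → Prop} {ε : ℝ≥0} (h : P ε) : infDist P ≤ ε :=
  sInf_le (Or.inl ⟨ε, h, rfl⟩)

lemma exists_of_infDist_lt {P : ℝ≥0 → Prop} {c : ℝ≥0} (h : infDist P < c) : ∃ ε ≤ c, P ε := by
  obtain ⟨d, ⟨ε, hε, rfl⟩ | rfl, hd⟩ := sInf_lt_iff.1 h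
  · exact ⟨ε, by exact_mod_cast hd.le, hε⟩
  · exact absurd hd not_top_lt

/-! ### Comparison of the interleavings up to homotopy -/

section UpToHomotopy

variable {M : Type u} [Category.{v} M] {W : MorphismProperty M}

lemma hoStructureMap_naturality (ε : ℝ≥0) {X Y : ℝ ⥤ M} (f : X ⟶ Y) :
    (weakEquiv W).Q.map f ≫ hoStructureMap W ε Y =
      hoStructureMap W ε X ≫ (hoShift W ε).map ((hoShift W ε).map ((weakEquiv W).Q.map f)) := by
  have h₁ := (structureMap M ε).naturality f
  have h₂ := (hoShiftIso W ε).inv.naturality f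
  have h₃ := (hoShiftIso W ε).inv.naturality ((shift M ε).map f)
  simp only [Functor.id_map, Functor.comp_map] at h₁ h₂ h₃
  simp only [hoStructureMap, Category.assoc]
  rw [← Functor.map_comp (hoShift W ε), ← h₂, Functor.map_comp, ← reassoc_of% h₃,
    ← Functor.map_comp_assoc, h₁, Functor.map_comp_assoc]

lemma InterleavedInHo.symm {ε : ℝ≥0} {X Y : ℝ ⥤ M} (h : InterleavedInHo W ε X Y) :
    InterleavedInHo W ε Y X := by
  obtain ⟨φ, ψ, h₁, h₂⟩ := h
  exact ⟨ψ, φ, h₂, h₁⟩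

lemma interleavedInHo_iff_of_weakEquiv {ε : ℝ≥0} {X X' : ℝ ⥤ M} (Y : ℝ ⥤ M) (f : X ⟶ X')
    (hf : weakEquiv W f) : InterleavedInHo W ε X Y ↔ InterleavedInHo W ε X' Y := by
  have := (weakEquiv W).Q_inverts f hf
  have nat := hoStructureMap_naturality (W := W) ε f
  constructor
  · rintro ⟨φ, ψ, h₁, h₂⟩
    refine ⟨inv ((weakEquiv W).Q.map f) ≫ φ, ψ ≫ (hoShift W ε).map ((weakEquiv W).Q.map f), ?_, ?_⟩
    · simp [reassoc_of% h₁, nat]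
    · simp [h₂]
  · rintro ⟨φ, ψ, h₁, h₂⟩
    refine ⟨(weakEquiv W).Q.map f ≫ φ, ψ ≫ inv ((hoShift W ε).map ((weakEquiv W).Q.map f)), ?_, ?_⟩
    · simp [reassoc_of% h₁, reassoc_of% nat]
    · simp [h₂]

lemma interleavedInHo_iff_of_weaklyEquivalent {ε : ℝ≥0} {X X' : ℝ ⥤ M} (Y : ℝ ⥤ M)
    (h : WeaklyEquivalent W X X') : InterleavedInHo W ε X Y ↔ InterleavedInHo W ε X' Y := by
  induction h with
  | rel _ _ h => obtain ⟨f, hf⟩ := h; exact interleavedInHo_iff_of_weakEquiv Y f hf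
  | refl => rfl
  | symm _ _ _ ih => exact ih.symm
  | trans _ _ _ _ _ ih ih' => exact ih.trans ih'

lemma Interleaved.interleavedInHo {ε : ℝ≥0} {X Y : ℝ ⥤ M} (h : Interleaved ε X Y) :
    InterleavedInHo W ε X Y := by
  have key : ∀ {A B : ℝ ⥤ M} (φ : A ⟶ (shift M ε).obj B) (ψ : B ⟶ (shift M ε).obj A),
      φ ≫ (shift M ε).map ψ = (structureMap M ε).app A →
      ((weakEquiv W).Q.map φ ≫ (hoShiftIso W ε).inv.app B) ≫ (hoShift W ε).map
        ((weakEquiv W).Q.map ψ ≫ (hoShiftIso W ε).inv.app A) = hoStructureMap W ε A := by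
    intro A B φ ψ h
    have nat := (hoShiftIso W ε).inv.naturality ψ
    simp only [Functor.comp_map] at nat
    rw [hoStructureMap, ← h, Functor.map_comp, Functor.map_comp, Category.assoc, Category.assoc,
      ← reassoc_of% nat]
  obtain ⟨φ, ψ, h₁, h₂⟩ := h
  exact ⟨_, _, key φ ψ h₁, key ψ φ h₂⟩

lemma HomotopyInterleaved.interleavedInHo {ε : ℝ≥0} {X Y : ℝ ⥤ M}
    (h : HomotopyInterleaved W ε X Y) : InterleavedInHo W ε X Y := by
  obtain ⟨X', Y', hX, hY, h⟩ := h
  rw [interleavedInHo_iff_of_weaklyEquivalent Y hX]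
  refine .symm ?_
  rw [interleavedInHo_iff_of_weaklyEquivalent X' hY]
  exact h.symm.interleavedInHo

/-- Transport of the relation `φ ≫ ψ^ε = (structure map)` along a functor `Φ` that commutes with
shifts. Here `s`, `sH`, `sB` stand for the shifts on three categories, and `τ` compares `sH` and
`sB` by means of the isomorphisms `i`, `e` and the maps `c`. -/
lemma comp_shift_eq_of_comparison {A H B : Type*} [Category* A] [Category* H] [Category* B]
    {s : A ⥤ A} {sH : H ⥤ H} {sB : B ⥤ B} {Q : A ⥤ H} {Φ : H ⥤ B} {R : A ⥤ B}
    (st : 𝟭 A ⟶ s ⋙ s) (i : Q ⋙ sH ≅ s ⋙ Q) (e : Q ⋙ Φ ≅ R) (τ : sH ⋙ Φ ⟶ Φ ⋙ sB)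
    (c : ∀ X, R.obj (s.obj X) ⟶ sB.obj (R.obj X))
    (hτ : ∀ X, τ.app (Q.obj X) =
      Φ.map (i.hom.app X) ≫ e.hom.app (s.obj X) ≫ c X ≫ sB.map (e.inv.app X))
    {X Y : A} (φ : Q.obj X ⟶ sH.obj (Q.obj Y)) (ψ : Q.obj Y ⟶ sH.obj (Q.obj X))
    (h : φ ≫ sH.map ψ =
      Q.map (st.app X) ≫ i.inv.app (s.obj X) ≫ sH.map (i.inv.app X)) :
    (e.inv.app X ≫ Φ.map φ ≫ τ.app (Q.obj Y) ≫ sB.map (e.hom.app Y)) ≫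
      sB.map (e.inv.app Y ≫ Φ.map ψ ≫ τ.app (Q.obj X) ≫ sB.map (e.hom.app X)) =
    R.map (st.app X) ≫ c (s.obj X) ≫ sB.map (c X) := by
  have n₁ : Φ.map (sH.map ψ) ≫ τ.app (sH.obj (Q.obj X)) = τ.app (Q.obj Y) ≫ sB.map (Φ.map ψ) :=
    τ.naturality ψ
  have n₂ : Φ.map (sH.map (i.inv.app X)) ≫ τ.app (sH.obj (Q.obj X)) =
      τ.app (Q.obj (s.obj X)) ≫ sB.map (Φ.map (i.inv.app X)) := τ.naturality (i.inv.app X)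
  have n₃ : Φ.map (Q.map (st.app X)) ≫ e.hom.app (s.obj (s.obj X)) =
      e.hom.app X ≫ R.map (st.app X) := e.hom.naturality (st.app X)
  have ee (Z : A) : e.inv.app Z ≫ e.hom.app Z = 𝟙 (R.obj Z) := e.inv_hom_id_app Z
  have ee' (Z : A) : sB.map (e.hom.app Z) ≫ sB.map (e.inv.app Z) =
      𝟙 (sB.obj (Φ.obj (Q.obj Z))) := by
    rw [← sB.map_comp, e.hom_inv_id_app]
    exact sB.map_id _
  have ii (Z : A) : Φ.map (i.inv.app Z) ≫ Φ.map (i.hom.app Z) = 𝟙 (Φ.obj (Q.obj (s.obj Z))) := by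
    rw [← Φ.map_comp, i.inv_hom_id_app]
    exact Φ.map_id _
  have hτ' (Z : A) : τ.app (Q.obj Z) ≫ sB.map (e.hom.app Z) =
      Φ.map (i.hom.app Z) ≫ e.hom.app (s.obj Z) ≫ c Z := by
    rw [hτ, Category.assoc, Category.assoc, Category.assoc, ← sB.map_comp, ee, sB.map_id,
      Category.comp_id]
  have i₁ (Z : A) : Φ.map (i.inv.app Z) ≫ τ.app (Q.obj Z) ≫ sB.map (e.hom.app Z) =
      e.hom.app (s.obj Z) ≫ c Z := by
    rw [hτ', reassoc_of% (ii Z)]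
  calc
    _ = e.inv.app X ≫ Φ.map φ ≫ (τ.app (Q.obj Y) ≫ sB.map (Φ.map ψ)) ≫ sB.map (τ.app (Q.obj X)) ≫
        sB.map (sB.map (e.hom.app X)) := by
      simp only [Category.assoc, sB.map_comp]
      rw [reassoc_of% (ee' Y)]
    _ = e.inv.app X ≫ Φ.map (φ ≫ sH.map ψ) ≫ τ.app (sH.obj (Q.obj X)) ≫ sB.map (τ.app (Q.obj X)) ≫
        sB.map (sB.map (e.hom.app X)) := by
      rw [← n₁, Φ.map_comp]
      simp only [Category.assoc]
    _ = e.inv.app X ≫ Φ.map (Q.map (st.app X)) ≫ Φ.map (i.inv.app (s.obj X)) ≫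
        τ.app (Q.obj (s.obj X)) ≫ sB.map (Φ.map (i.inv.app X) ≫ τ.app (Q.obj X) ≫
          sB.map (e.hom.app X)) := by
      rw [h, Φ.map_comp, Φ.map_comp, sB.map_comp, sB.map_comp]
      simp only [Category.assoc]
      rw [reassoc_of% n₂]
    _ = R.map (st.app X) ≫ c (s.obj X) ≫ sB.map (c X) := by
      rw [i₁, sB.map_comp, reassoc_of% (i₁ (s.obj X)), reassoc_of% n₃, reassoc_of% (ee X)]

/-- The comparison functor `Ho(M^(ℝ, ≤)) ⥤ Ho(M)^(ℝ, ≤)` commutes with the shifts up to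
isomorphism and matches the structure maps, so it carries interleavings to interleavings. -/
lemma InterleavedInHo.homotopyCommutativeInterleaved {ε : ℝ≥0} {X Y : ℝ ⥤ M}
    (h : InterleavedInHo W ε X Y) : HomotopyCommutativeInterleaved W ε X Y := by
  let R := (Functor.whiskeringRight ℝ M W.Localization).obj W.Q
  have hR : (weakEquiv W).IsInvertedBy R := fun A B f hf => by
    have : ∀ a, IsIso ((R.map f).app a) := fun a => W.Q_inverts (f.app a) (hf a)
    exact NatIso.isIso_of_isIso_app _
  let Q := (weakEquiv W).Q
  let Φ := Localization.lift R hR Q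
  let e : Q ⋙ Φ ≅ R := Localization.fac R hR Q
  let S := shift W.Localization ε
  -- Shifting and applying `W.Q` objectwise commute definitionally.
  let c : shift M ε ⋙ R ⟶ R ⋙ S := { app := fun A => 𝟙 (shift M ε ⋙ R |>.obj A) }
  let t : Q ⋙ hoShift W ε ⋙ Φ ⟶ Q ⋙ Φ ⋙ S :=
    Functor.whiskerRight (hoShiftIso W ε).hom Φ ≫ Functor.whiskerLeft (shift M ε) e.hom ≫ c ≫
      Functor.whiskerRight e.inv S
  let τ : hoShift W ε ⋙ Φ ⟶ Φ ⋙ S :=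
    Localization.liftNatTrans Q (weakEquiv W) _ _ _ _ t
  have hτ (A : ℝ ⥤ M) : τ.app (Q.obj A) = Φ.map ((hoShiftIso W ε).hom.app A) ≫
      e.hom.app ((shift M ε).obj A) ≫ c.app A ≫ S.map (e.inv.app A) := by
    simp [τ, t, Localization.liftNatTrans_app]
  have key {A B : ℝ ⥤ M} (φ : Q.obj A ⟶ (hoShift W ε).obj (Q.obj B))
      (ψ : Q.obj B ⟶ (hoShift W ε).obj (Q.obj A))
      (h : φ ≫ (hoShift W ε).map ψ = hoStructureMap W ε A) :
      (e.inv.app A ≫ Φ.map φ ≫ τ.app _ ≫ S.map (e.hom.app B)) ≫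
        S.map (e.inv.app B ≫ Φ.map ψ ≫ τ.app _ ≫ S.map (e.hom.app A)) =
        (structureMap _ ε).app (A ⋙ W.Q) := by
    refine (comp_shift_eq_of_comparison (structureMap M ε) (hoShiftIso W ε) e τ (fun A => c.app A)
      hτ φ ψ h).trans ?_
    ext a
    exact (congrArg (fun f => _ ≫ f) (Category.id_comp _)).trans (Category.comp_id _)
  obtain ⟨φ, ψ, h₁, h₂⟩ := h
  exact ⟨_, _, key φ ψ h₁, key ψ φ h₂⟩

end UpToHomotopy

/-! ### Transfer of interleavings along trivial fibrations -/

section Transfer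

open Limits

variable {M : Type u} [Category.{v} M] (T : MorphismProperty M)

/-- `X` and `Y` are dominated by a common object through morphisms that are objectwise in `T`. For
`T` the class of trivial fibrations this is weak equivalence, in a form that composes by means of
pullbacks. -/
def SpanEquivalent (X Y : ℝ ⥤ M) : Prop :=
  ∃ (Z : ℝ ⥤ M) (f : Z ⟶ X) (g : Z ⟶ Y), T.functorCategory ℝ f ∧ T.functorCategory ℝ g

/-- The variant of homotopy interleaving with weak equivalence replaced by `SpanEquivalent T`. -/
def SpanInterleaved (ε : ℝ≥0) (X Y : ℝ ⥤ M) : Prop :=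
  ∃ X' Y' : ℝ ⥤ M, SpanEquivalent T X X' ∧ SpanEquivalent T Y Y' ∧ Interleaved ε X' Y'

variable {T}

lemma SpanEquivalent.symm {X Y : ℝ ⥤ M} (h : SpanEquivalent T X Y) : SpanEquivalent T Y X := by
  obtain ⟨Z, f, g, hf, hg⟩ := h
  exact ⟨Z, g, f, hg, hf⟩

lemma SpanEquivalent.of_hom [T.ContainsIdentities] {X Y : ℝ ⥤ M} (f : X ⟶ Y)
    (hf : T.functorCategory ℝ f) : SpanEquivalent T X Y :=
  ⟨X, 𝟙 X, f, fun _ => T.id_mem _, hf⟩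

lemma SpanEquivalent.trans [HasPullbacks M] [T.IsStableUnderComposition] [T.IsStableUnderBaseChange]
    {X Y Z : ℝ ⥤ M} (h : SpanEquivalent T X Y) (h' : SpanEquivalent T Y Z) :
    SpanEquivalent T X Z := by
  obtain ⟨A, f, g, hf, hg⟩ := h
  obtain ⟨B, f', g', hf', hg'⟩ := h'
  have sq := IsPullback.of_hasPullback g f'
  refine ⟨pullback g f', pullback.fst g f' ≫ f, pullback.snd g f' ≫ g', ?_, ?_⟩
  · exact fun a => T.comp_mem _ _ ((T.functorCategory ℝ).of_isPullback sq.flip hf' a) (hf a)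
  · exact fun a => T.comp_mem _ _ ((T.functorCategory ℝ).of_isPullback sq hg a) (hg' a)

lemma SpanEquivalent.weaklyEquivalent {W : MorphismProperty M} (hTW : T ≤ W) {X Y : ℝ ⥤ M}
    (h : SpanEquivalent T X Y) : WeaklyEquivalent W X Y := by
  obtain ⟨Z, f, g, hf, hg⟩ := h
  exact .trans _ Z _ (.symm _ _ (.rel _ _ ⟨f, fun a => hTW _ (hf a)⟩))
    (.rel _ _ ⟨g, fun a => hTW _ (hg a)⟩)

lemma SpanInterleaved.homotopyInterleaved {W : MorphismProperty M} (hTW : T ≤ W) {ε : ℝ≥0}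
    {X Y : ℝ ⥤ M} (h : SpanInterleaved T ε X Y) : HomotopyInterleaved W ε X Y := by
  obtain ⟨X', Y', hX, hY, h⟩ := h
  exact ⟨X', Y', hX.weaklyEquivalent hTW, hY.weaklyEquivalent hTW, h⟩

lemma SpanInterleaved.symm {ε : ℝ≥0} {X Y : ℝ ⥤ M} (h : SpanInterleaved T ε X Y) :
    SpanInterleaved T ε Y X := by
  obtain ⟨X', Y', hX, hY, h⟩ := h
  exact ⟨Y', X', hY, hX, h.symm⟩

lemma SpanEquivalent.refl [T.ContainsIdentities] (X : ℝ ⥤ M) : SpanEquivalent T X X :=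
  .of_hom (𝟙 X) fun _ => T.id_mem _

lemma Interleaved.spanInterleaved [T.ContainsIdentities] {ε : ℝ≥0} {X Y : ℝ ⥤ M}
    (h : Interleaved ε X Y) : SpanInterleaved T ε X Y :=
  ⟨X, Y, .refl X, .refl Y, h⟩

lemma shift_map_structureMap (ε : ℝ≥0) (X : ℝ ⥤ M) :
    (shift M ε).map ((structureMap M ε).app X) = (structureMap M ε).app ((shift M ε).obj X) := by
  ext a
  exact congrArg X.map (Subsingleton.elim _ _)

instance [HasPullbacks M] (ε : ℝ≥0) : PreservesLimitsOfShape WalkingCospan (shift M ε) :=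
  inferInstanceAs (PreservesLimitsOfShape WalkingCospan
    ((Functor.whiskeringLeft ℝ ℝ M).obj (translation ε)))

/-- An interleaving between `A` and `B` pulls back along `p : C ⟶ A`: the object `C` is interleaved
with `B' = B ×_{A^ε} C^ε`. -/
lemma Interleaved.exists_pullback [HasPullbacks M] [T.IsStableUnderBaseChange] {ε : ℝ≥0}
    {A B C : ℝ ⥤ M} (h : Interleaved ε A B) (p : C ⟶ A) (hp : T.functorCategory ℝ p) :
    ∃ (B' : ℝ ⥤ M) (q : B' ⟶ B), T.functorCategory ℝ q ∧ Interleaved ε C B' := by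
  obtain ⟨φ, ψ, h₁, h₂⟩ := h
  let S := shift M ε
  let st := structureMap M ε
  have nat {X Y : ℝ ⥤ M} (f : X ⟶ Y) : f ≫ st.app Y = st.app X ≫ S.map (S.map f) := st.naturality f
  have sq := IsPullback.of_hasPullback ψ (S.map p)
  have sq' := sq.map S
  have sq'' := sq'.map S
  let q := pullback.fst ψ (S.map p)
  let r := pullback.snd ψ (S.map p)
  have w : (p ≫ φ) ≫ S.map ψ = st.app C ≫ S.map (S.map p) := by
    rw [Category.assoc, h₁, nat]
  let l : C ⟶ S.obj (pullback ψ (S.map p)) := sq'.lift (p ≫ φ) (st.app C) w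
  have hq : l ≫ S.map q = p ≫ φ := sq'.lift_fst _ _ w
  have hr : l ≫ S.map r = st.app C := sq'.lift_snd _ _ w
  have hqr : q ≫ ψ = r ≫ S.map p := sq.w
  refine ⟨_, q, (T.functorCategory ℝ).of_isPullback sq.flip (fun a => hp _), l, r, hr, ?_⟩
  refine sq''.hom_ext ?_ ?_
  · calc (r ≫ S.map l) ≫ S.map (S.map q) = r ≫ S.map p ≫ S.map φ := by
          rw [Category.assoc, ← S.map_comp, hq, S.map_comp]
      _ = q ≫ st.app B := by rw [← reassoc_of% hqr, h₂]
      _ = _ := nat q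
  · calc (r ≫ S.map l) ≫ S.map (S.map r) = r ≫ S.map (st.app C) := by
          rw [Category.assoc, ← S.map_comp, hr]
      _ = r ≫ st.app (S.obj C) := by rw [← shift_map_structureMap]
      _ = _ := nat r

/-- The triangle inequality: after pulling back both interleavings to a common object above the two
middle objects, they can be composed. -/
lemma SpanInterleaved.trans [HasPullbacks M] [T.IsStableUnderComposition]
    [T.IsStableUnderBaseChange] {ε δ : ℝ≥0} {X Y Z : ℝ ⥤ M}
    (h : SpanInterleaved T ε X Y) (h' : SpanInterleaved T δ Y Z) :
    SpanInterleaved T (ε + δ) X Z := by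
  obtain ⟨X₁, Y₁, ⟨X₀, x₀, x₁, hx₀, hx₁⟩, hY₁, h⟩ := h
  obtain ⟨Y₂, Z₂, hY₂, ⟨Z₀, z₀, z₂, hz₀, hz₂⟩, h'⟩ := h'
  obtain ⟨Y₀, y₁, y₂, hy₁, hy₂⟩ := hY₁.symm.trans hY₂
  obtain ⟨X₃, x₃, hx₃, h⟩ := h.symm.exists_pullback y₁ hy₁
  obtain ⟨Z₃, z₃, hz₃, h'⟩ := h'.exists_pullback y₂ hy₂
  have sx := IsPullback.of_hasPullback x₁ x₃
  have sz := IsPullback.of_hasPullback z₂ z₃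
  refine ⟨X₃, Z₃, ⟨pullback x₁ x₃, pullback.fst x₁ x₃ ≫ x₀, pullback.snd x₁ x₃, ?_, ?_⟩,
    ⟨pullback z₂ z₃, pullback.fst z₂ z₃ ≫ z₀, pullback.snd z₂ z₃, ?_, ?_⟩, h.symm.trans h'⟩
  · exact fun a => T.comp_mem _ _ ((T.functorCategory ℝ).of_isPullback sx.flip hx₃ a) (hx₀ a)
  · exact fun a => (T.functorCategory ℝ).of_isPullback sx hx₁ a
  · exact fun a => T.comp_mem _ _ ((T.functorCategory ℝ).of_isPullback sz.flip hz₃ a) (hz₀ a)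
  · exact fun a => (T.functorCategory ℝ).of_isPullback sz hz₂ a

end Transfer

/-! ### Trivial fibrations of complexes -/

section TrivialFibrations

open Limits HomologicalComplex

variable {A : Type*} [Category* A] [Abelian A] {ι : Type*} {c : ComplexShape ι}

lemma quasiIso_g_of_acyclic {S : ShortComplex (HomologicalComplex A c)} (hS : S.ShortExact)
    (h : S.X₁.Acyclic) : QuasiIso S.g := by
  have hz (i : ι) : IsZero (S.X₁.homology i) := (exactAt_iff_isZero_homology _ _).1 (h i)
  rw [quasiIso_iff]
  intro i
  rw [quasiIsoAt_iff_isIso_homologyMap]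
  have : Mono (homologyMap S.g i) := (hS.homology_exact₂ i).mono_g ((hz i).eq_of_src _ _)
  have : Epi (homologyMap S.g i) := by
    by_cases hi : ∃ j, c.Rel i j
    · obtain ⟨j, hij⟩ := hi
      exact (hS.homology_exact₃ i j hij).epi_f ((hz j).eq_of_tgt _ _)
    · have := hS.epi_g
      exact epi_homologyMap_of_epi_of_not_rel S.g i (by simpa using hi)
  exact isIso_of_mono_of_epi _

variable (A c) in
/-- The epimorphisms of complexes that are quasi-isomorphisms; these are the trivial fibrations of
the projective model structure. -/
def trivialFibration : MorphismProperty (HomologicalComplex A c) :=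
  MorphismProperty.epimorphisms _ ⊓ quasiIso A c

lemma shortExact_kernel {K L : HomologicalComplex A c} (f : K ⟶ L) [Epi f] :
    (ShortComplex.mk (kernel.ι f) f (kernel.condition f)).ShortExact where
  exact := ShortComplex.exact_of_f_is_kernel _ (kernelIsKernel f)

lemma trivialFibration_iff_acyclic {K L : HomologicalComplex A c} (f : K ⟶ L) [Epi f] :
    trivialFibration A c f ↔ (kernel f).Acyclic := by
  refine ⟨fun h => ?_, fun h => ⟨‹_›, ?_⟩⟩
  · exact (shortExact_kernel f).acyclic_X₁ h.2
  · exact quasiIso_g_of_acyclic (shortExact_kernel f) h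

instance : (trivialFibration A c).IsMultiplicative := by
  unfold trivialFibration
  infer_instance

instance : (trivialFibration A c).IsStableUnderBaseChange := by
  refine ⟨fun {X Y Y' S f g f' g'} sq hg => ?_⟩
  have : Epi g := hg.1
  have : Epi g' := Abelian.epi_snd_of_isLimit g f sq.isLimit
  have := isIso_kernel_map_of_isPullback sq.flip
  rw [trivialFibration_iff_acyclic] at hg ⊢
  exact fun i => (hg i).of_iso (asIso (kernel.map _ _ _ _ sq.w.symm)).symm

end TrivialFibrations

/-! ### Formality in the presence of projective resolutions of length one -/

section Formality

open Limits HomologicalComplex CochainComplex CochainComplex.HomComplex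

variable {A : Type*} [Category* A] [Abelian A]

/-- The cochain complex with zero differential and given terms. -/
abbrev zeroDifferential (G : ℤ → A) : CochainComplex A ℤ where
  X := G
  d _ _ := 0

/-- A family of morphisms gives a morphism of complexes with zero differential. -/
abbrev zeroDifferentialMap {G G' : ℤ → A} (f : ∀ k, G k ⟶ G' k) :
    zeroDifferential G ⟶ zeroDifferential G' where
  f := f
  comm' _ _ _ := comp_zero.trans zero_comp.symm

/-- A family of morphisms to the cycles of `D` gives a morphism from a complex with zero
differential. -/
abbrev zeroDifferentialDesc {G : ℤ → A} {D : CochainComplex A ℤ} (z : ∀ k, G k ⟶ D.cycles k) :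
    zeroDifferential G ⟶ D where
  f k := z k ≫ D.iCycles k
  comm' i j _ := by
    rw [Category.assoc, iCycles_d, comp_zero]
    exact zero_comp.symm

/-- `H^k` of a complex with zero differential is its `k`-th term. -/
def zeroDifferentialHomologyIso (G : ℤ → A) (k : ℤ) :
    G k ≅ (zeroDifferential G).homology k :=
  ((zeroDifferential G).iCyclesIso k (k + 1) (by simp) rfl).symm ≪≫
    (zeroDifferential G).isoHomologyπ (k - 1) k (by simp) rfl

lemma zeroDifferentialHomologyIso_hom_map_desc {G : ℤ → A} {D : CochainComplex A ℤ}
    (z : ∀ k, G k ⟶ D.cycles k) (k : ℤ) :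
    (zeroDifferentialHomologyIso G k).hom ≫ homologyMap (zeroDifferentialDesc z) k =
      z k ≫ D.homologyπ k := by
  have h : cyclesMap (zeroDifferentialDesc z) k = (zeroDifferential G).iCycles k ≫ z k := by
    rw [← cancel_mono (D.iCycles k), cyclesMap_i, Category.assoc]
  simp only [zeroDifferentialHomologyIso, Iso.trans_hom, Iso.symm_hom, isoHomologyπ_hom,
    Category.assoc, homologyπ_naturality, h, Iso.inv_comp_eq, iCyclesIso_hom]

lemma zeroDifferentialHomologyIso_hom_naturality {G G' : ℤ → A} (f : ∀ k, G k ⟶ G' k) (k : ℤ) :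
    (zeroDifferentialHomologyIso G k).hom ≫ homologyMap (zeroDifferentialMap f) k =
      f k ≫ (zeroDifferentialHomologyIso G' k).hom := by
  have h : (zeroDifferential G).iCycles k ≫ f k =
      cyclesMap (zeroDifferentialMap f) k ≫ (zeroDifferential G').iCycles k :=
    (cyclesMap_i (zeroDifferentialMap f) k).symm
  have h' : f k ≫ ((zeroDifferential G').iCyclesIso k (k + 1) (by simp) rfl).inv =
      ((zeroDifferential G).iCyclesIso k (k + 1) (by simp) rfl).inv ≫
        cyclesMap (zeroDifferentialMap f) k := by
    rw [Iso.comp_inv_eq, Category.assoc, Iso.eq_inv_comp]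
    exact h
  simp only [zeroDifferentialHomologyIso, Iso.trans_hom, Iso.symm_hom, isoHomologyπ_hom,
    Category.assoc, homologyπ_naturality, reassoc_of% h']

lemma shortExact_zeroDifferential {G₁ G₂ G₃ : ℤ → A} (f : ∀ k, G₁ k ⟶ G₂ k)
    (g : ∀ k, G₂ k ⟶ G₃ k) (w : ∀ k, f k ≫ g k = 0)
    (h : ∀ k, (ShortComplex.mk (f k) (g k) (w k)).ShortExact) :
    (ShortComplex.mk (zeroDifferentialMap f) (zeroDifferentialMap g)
      (by ext k; exact w k)).ShortExact := by
  rw [shortExact_iff_degreewise_shortExact]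
  exact h

lemma acyclic_mappingCocone_id (D : CochainComplex A ℤ) : (mappingCocone (𝟙 D)).Acyclic := by
  open ZeroObject in
  have hS : (ShortComplex.mk (𝟙 D) (0 : D ⟶ 0) comp_zero).ShortExact :=
    { exact := ((ShortComplex.exact_iff_epi _ rfl).2 (inferInstanceAs (Epi (𝟙 D))))
      mono_f := inferInstanceAs (Mono (𝟙 D))
      epi_g := (isZero_zero _).epi _ }
  have := mappingCone.quasiIso_descShortComplex hS
  intro k
  rw [exactAt_iff_isZero_homology]
  refine IsZero.of_iso ?_ ((ShiftSequence.shiftIso A (-1) k (-1 + k) rfl).app (mappingCone (𝟙 D)))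
  have e := asIso (homologyMap (mappingCone.descShortComplex
    (ShortComplex.mk (𝟙 D) (0 : D ⟶ 0) comp_zero)) (-1 + k))
  exact ((homologyFunctor A (ComplexShape.up ℤ) (-1 + k)).map_isZero (isZero_zero _)).of_iso e

instance epi_mappingCocone_fst (D : CochainComplex A ℤ) : Epi (mappingCocone.fst (𝟙 D)) := by
  have (p : ℤ) : Epi ((mappingCocone.fst (𝟙 D)).f p) :=
    (IsSplitEpi.mk' ⟨_, mappingCocone.inl_v_fst_f (𝟙 D) p⟩).epi
  exact epi_of_epi_f _ this

lemma quasiIso_biprod_inl (K : CochainComplex A ℤ) {N : CochainComplex A ℤ} (hN : N.Acyclic) :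
    QuasiIso (biprod.inl : K ⟶ K ⊞ N) := by
  have : QuasiIso (biprod.fst : K ⊞ N ⟶ K) := quasiIso_g_of_acyclic
    (S := ShortComplex.mk (biprod.inr : N ⟶ K ⊞ N) (biprod.fst : K ⊞ N ⟶ K) (by simp))
    (ShortComplex.Splitting.mk biprod.snd biprod.inl (by simp) (by simp)
      (by simp [add_comm])).shortExact hN
  have : QuasiIso ((biprod.inl : K ⟶ K ⊞ N) ≫ biprod.fst) := by
    rw [biprod.inl_fst]
    infer_instance
  exact quasiIso_of_comp_right _ (biprod.fst : K ⊞ N ⟶ K)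

/-- If every cohomology object of `D` has a projective resolution of length one, then `D` is
connected to its cohomology, taken with zero differential, by a span of trivial fibrations. -/
theorem exists_span_homology (D : CochainComplex A ℤ) (P₁ P₀ : ℤ → A)
    [∀ k, Projective (P₁ k)] [∀ k, Projective (P₀ k)]
    (f : ∀ k, P₁ k ⟶ P₀ k) (g : ∀ k, P₀ k ⟶ D.homology k) (w : ∀ k, f k ≫ g k = 0)
    (h : ∀ k, (ShortComplex.mk (f k) (g k) (w k)).ShortExact) :
    ∃ (E : CochainComplex A ℤ) (p : E ⟶ D) (q : E ⟶ zeroDifferential fun k => D.homology k),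
      trivialFibration A _ p ∧ trivialFibration A _ q := by
  -- The resolution lifts to the cycles, and its relations lift to the boundaries.
  let z (k : ℤ) : P₀ k ⟶ D.cycles k := Projective.factorThru (g k) (D.homologyπ k)
  have hz (k : ℤ) : z k ≫ D.homologyπ k = g k := Projective.factorThru_comp _ _
  have hex (k j : ℤ) (hkj : k + -1 = j) :
      (ShortComplex.mk (D.toCycles j k) (D.homologyπ k) (by simp)).Exact :=
    ShortComplex.exact_of_g_is_cokernel _ (D.homologyIsCokernel j k (by simp; lia))
  let α (k j : ℤ) (hkj : k + -1 = j) : P₁ k ⟶ D.X j :=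
    (hex k j hkj).liftFromProjective (f k ≫ z k) (by simp [hz, w])
  have hα (k j : ℤ) (hkj : k + -1 = j) : α k j hkj ≫ D.toCycles j k = f k ≫ z k :=
    (hex k j hkj).liftFromProjective_comp _ _
  let S := ShortComplex.mk (zeroDifferentialMap f) (zeroDifferentialMap g) (by ext k; exact w k)
  have hS : S.ShortExact := shortExact_zeroDifferential f g w h
  let β : zeroDifferential P₀ ⟶ D := zeroDifferentialDesc z
  let α' : Cochain (zeroDifferential P₁) D (-1) := Cochain.mk α
  have hα' : δ (-1) 0 α' = Cochain.ofHom (S.f ≫ β) := by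
    ext k
    have h₀ : (zeroDifferential P₁).d k (k + 1) = 0 := rfl
    rw [δ_v (-1) 0 (by simp) α' k k (by simp) (k - 1) (k + 1) rfl rfl, h₀, zero_comp, smul_zero,
      add_zero, Cochain.ofHom_v]
    change α k (k - 1) (sub_eq_add_neg k 1).symm ≫ D.d (k - 1) k = f k ≫ z k ≫ D.iCycles k
    rw [← D.toCycles_i, reassoc_of% (hα k (k - 1) (sub_eq_add_neg k 1).symm)]
  -- Both morphisms out of the cone restrict to the given epimorphism `P₀ ⟶ H` in cohomology, so
  -- they induce the same map, and the second is a quasi-isomorphism.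
  let e : mappingCone S.f ⟶ D := mappingCone.desc S.f α' β hα'
  let e' := mappingCone.descShortComplex S
  have he : mappingCone.inr S.f ≫ e = β := by simp [e]
  have he' : mappingCone.inr S.f ≫ e' = S.g := by simp [e']
  have qe' : QuasiIso e' := mappingCone.quasiIso_descShortComplex hS
  have qe : QuasiIso e := by
    rw [quasiIso_iff]
    intro k
    rw [quasiIsoAt_iff_isIso_homologyMap]
    have : Epi (g k) := (h k).epi_g
    let j : D.homology k ≅ S.X₃.homology k := zeroDifferentialHomologyIso (fun k => D.homology k) k
    let i₀ : P₀ k ≅ S.X₂.homology k := zeroDifferentialHomologyIso P₀ k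
    have hg : i₀.hom ≫ homologyMap S.g k = g k ≫ j.hom :=
      zeroDifferentialHomologyIso_hom_naturality g k
    have hβ : i₀.hom ≫ homologyMap β k = g k := by
      rw [← hz]
      exact zeroDifferentialHomologyIso_hom_map_desc z k
    have ρ : homologyMap S.g k = homologyMap β k ≫ j.hom := by
      rw [← cancel_epi i₀.hom, hg, reassoc_of% hβ]
    have : Epi (homologyMap S.g k) := by
      have : Epi (i₀.hom ≫ homologyMap S.g k) := by rw [hg]; infer_instance
      exact epi_of_epi i₀.hom _
    have : Epi (homologyMap (mappingCone.inr S.f) k) := by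
      have : Epi (homologyMap (mappingCone.inr S.f) k ≫ homologyMap e' k) := by
        rw [← homologyMap_comp, he']
        infer_instance
      have : homologyMap (mappingCone.inr S.f) k =
        (homologyMap (mappingCone.inr S.f) k ≫ homologyMap e' k) ≫ inv (homologyMap e' k) := by simp
      rw [this]
      infer_instance
    have key : homologyMap e k ≫ j.hom = homologyMap e' k := by
      rw [← cancel_epi (homologyMap (mappingCone.inr S.f) k), ← homologyMap_comp_assoc,
        ← homologyMap_comp, he, he', ρ]
    have : IsIso (homologyMap e k ≫ j.hom) := key ▸ inferInstance
    exact IsIso.of_isIso_comp_right (homologyMap e k) j.hom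
  have : Epi e' := by
    have := hS.epi_g
    rw [← he'] at this
    exact epi_of_epi (mappingCone.inr S.f) e'
  -- A contractible summand makes the first quasi-isomorphism an epimorphism.
  let N := mappingCocone (𝟙 D)
  have qinl : QuasiIso (biprod.inl : mappingCone S.f ⟶ mappingCone S.f ⊞ N) :=
    quasiIso_biprod_inl _ (acyclic_mappingCocone_id D)
  have qdesc {L : CochainComplex A ℤ} (a : mappingCone S.f ⟶ L) (b : N ⟶ L) (ha : QuasiIso a) :
      QuasiIso (biprod.desc a b) := by
    have : QuasiIso ((biprod.inl : mappingCone S.f ⟶ mappingCone S.f ⊞ N) ≫ biprod.desc a b) := by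
      rwa [biprod.inl_desc]
    exact quasiIso_of_comp_left (biprod.inl : mappingCone S.f ⟶ mappingCone S.f ⊞ N) _
  refine ⟨mappingCone S.f ⊞ N, biprod.desc e (mappingCocone.fst _), biprod.desc e' 0,
    ⟨?_, qdesc _ _ qe⟩, ⟨?_, qdesc _ _ qe'⟩⟩
  · have : Epi ((biprod.inr : N ⟶ mappingCone S.f ⊞ N) ≫
        biprod.desc e (mappingCocone.fst (𝟙 D))) := by
      rw [biprod.inr_desc]
      infer_instance
    exact epi_of_epi (biprod.inr : N ⟶ mappingCone S.f ⊞ N) _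
  · have : Epi ((biprod.inl : mappingCone S.f ⟶ mappingCone S.f ⊞ N) ≫ biprod.desc e' 0) := by
      rwa [biprod.inl_desc]
    exact epi_of_epi (biprod.inl : mappingCone S.f ⟶ mappingCone S.f ⊞ N) _

end Formality

/-! ### Free persistence modules over the integers -/

section Free

open Limits DirectSum

variable {K : Type u} [Field K]

/-- The persistence module over `ℤ` freely generated by the vector spaces `V m`, where `V m` is
placed in degree `s m`: its value at `n` is the sum of the `V m` with `s m ≤ n`. -/
def freeModule (s : ℤ → ℤ) (V : ℤ → ModuleCat.{u} K) : ℤ ⥤ ModuleCat.{u} K where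
  obj n := ModuleCat.of K (⨁ m : {m : ℤ // s m ≤ n}, V m)
  map {n n'} h := ModuleCat.ofHom (toModule K _ _ fun m =>
    lof K {m : ℤ // s m ≤ n'} (fun m => V m) ⟨m, m.2.trans (leOfHom h)⟩)
  map_id n := by
    ext : 1
    refine linearMap_ext K fun m => ?_
    ext x
    simp
  map_comp {n n' n''} h h' := by
    ext : 1
    refine linearMap_ext K fun m => ?_
    ext x
    simp

namespace freeModule

variable {s : ℤ → ℤ} {V : ℤ → ModuleCat.{u} K}

/-- The inclusion of the generators `V m` in the value at `n`. -/
def ι (s : ℤ → ℤ) (V : ℤ → ModuleCat.{u} K) (m n : ℤ) (h : s m ≤ n) :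
    V m ⟶ (freeModule s V).obj n :=
  ModuleCat.ofHom (lof K {m : ℤ // s m ≤ n} (fun m => V m) ⟨m, h⟩)

lemma obj_hom_ext {n : ℤ} {E : ModuleCat.{u} K} {f g : (freeModule s V).obj n ⟶ E}
    (h : ∀ (m : ℤ) (hm : s m ≤ n), ι s V m n hm ≫ f = ι s V m n hm ≫ g) : f = g := by
  ext : 1
  refine linearMap_ext K fun m => ?_
  exact congrArg ModuleCat.Hom.hom (h m m.2)

/-- A morphism out of a value of a free persistence module. -/
def objDesc {n : ℤ} {E : ModuleCat.{u} K} (f : ∀ m, s m ≤ n → (V m ⟶ E)) :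
    (freeModule s V).obj n ⟶ E :=
  ModuleCat.ofHom (toModule K _ _ fun m => (f m m.2).hom)

lemma ι_objDesc {n : ℤ} {E : ModuleCat.{u} K} (f : ∀ m, s m ≤ n → (V m ⟶ E)) (m : ℤ)
    (hm : s m ≤ n) : ι s V m n hm ≫ objDesc f = f m hm := by
  ext x
  exact toModule_lof K (M := fun m : {m : ℤ // s m ≤ n} => V m)
    (φ := fun m => (f m m.2).hom) ⟨m, hm⟩ x

lemma ι_map {m n n' : ℤ} (h : s m ≤ n) (f : n ⟶ n') :
    ι s V m n h ≫ (freeModule s V).map f = ι s V m n' (h.trans (leOfHom f)) := by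
  ext x
  exact toModule_lof K (M := fun m : {m : ℤ // s m ≤ n} => V m)
    (φ := fun m => lof K {m : ℤ // s m ≤ n'} (fun m => V m) ⟨m, m.2.trans (leOfHom f)⟩) ⟨m, h⟩ x

/-- The morphism out of a free persistence module with given values on the generators. -/
def desc {E : ℤ ⥤ ModuleCat.{u} K} (f : ∀ m, V m ⟶ E.obj (s m)) : freeModule s V ⟶ E where
  app n := objDesc fun m hm => f m ≫ E.map (homOfLE hm)
  naturality n n' h := by
    refine obj_hom_ext fun m hm => ?_
    rw [reassoc_of% (ι_map (s := s) (V := V)), ι_objDesc,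
      reassoc_of% (ι_objDesc (s := s) (V := V)), Category.assoc, ← E.map_comp]
    rfl

lemma ι_desc_app {E : ℤ ⥤ ModuleCat.{u} K} (f : ∀ m, V m ⟶ E.obj (s m)) (m n : ℤ)
    (hm : s m ≤ n) : ι s V m n hm ≫ (desc f).app n = f m ≫ E.map (homOfLE hm) :=
  ι_objDesc (fun m hm => f m ≫ E.map (homOfLE hm)) m hm

lemma hom_ext {E : ℤ ⥤ ModuleCat.{u} K} {f g : freeModule s V ⟶ E}
    (h : ∀ m, ι s V m (s m) le_rfl ≫ f.app (s m) = ι s V m (s m) le_rfl ≫ g.app (s m)) :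
    f = g := by
  ext n : 2
  refine obj_hom_ext fun m hm => ?_
  have e : ι s V m n hm = ι s V m (s m) le_rfl ≫ (freeModule s V).map (homOfLE hm) :=
    (ι_map _ _).symm
  rw [e, Category.assoc, Category.assoc, f.naturality, g.naturality, reassoc_of% (h m)]

instance : Projective (freeModule s V) where
  factors {E X} f e _ := by
    have he (n : ℤ) : Epi (e.app n) := inferInstance
    have (m : ℤ) : Projective (V m) := inferInstance
    refine ⟨desc fun m => Projective.factorThru (ι s V m (s m) le_rfl ≫ f.app (s m)) (e.app (s m)),
      hom_ext fun m => ?_⟩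
    rw [NatTrans.comp_app, reassoc_of% (ι_desc_app (s := s) (V := V)), e.naturality,
      Projective.factorThru_comp_assoc,
      Category.assoc, ← f.naturality,
      reassoc_of% (ι_map (s := s) (V := V))]

end freeModule

variable (H : ℤ ⥤ ModuleCat.{u} K)

/-- The inclusion of `H_m` in the value at `n ≥ m` of the module with generators `H_m` in
degree `m`. -/
abbrev coverι (m n : ℤ) (h : m ≤ n) : H.obj m ⟶ (freeModule id H.obj).obj n :=
  freeModule.ι id H.obj m n h

/-- The inclusion of `H_m` in the value at `n ≥ m + 1` of the module with generators `H_m` in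
degree `m + 1`. -/
abbrev relι (m n : ℤ) (h : m + 1 ≤ n) : H.obj m ⟶ (freeModule (· + 1) H.obj).obj n :=
  freeModule.ι (· + 1) H.obj m n h

/-- The free cover of `H` on generators `H_m` in degree `m`. -/
def freeCover : freeModule id H.obj ⟶ H := freeModule.desc fun m => 𝟙 (H.obj m)

/-- The relations of the free cover: a generator `x ∈ H_m` in degree `m + 1` is sent to the
difference of `x` and of its image in `H_{m+1}`. -/
def freeRelations : freeModule (· + 1) H.obj ⟶ freeModule id H.obj :=
  freeModule.desc fun m =>
    coverι H m (m + 1) (by simp) -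
      H.map (homOfLE (by simp : m ≤ m + 1)) ≫ coverι H (m + 1) (m + 1) le_rfl

lemma coverι_freeCover {m n : ℤ} (h : m ≤ n) :
    coverι H m n h ≫ (freeCover H).app n = H.map (homOfLE h) :=
  (freeModule.ι_desc_app (s := id) (fun m => 𝟙 (H.obj m)) m n h).trans (Category.id_comp _)

lemma relι_freeRelations {m n : ℤ} (h : m + 1 ≤ n) :
    relι H m n h ≫ (freeRelations H).app n =
      coverι H m n (by lia) -
        H.map (homOfLE (by simp : m ≤ m + 1)) ≫ coverι H (m + 1) n h := by
  rw [freeRelations, freeModule.ι_desc_app, Preadditive.sub_comp, Category.assoc, freeModule.ι_map,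
    freeModule.ι_map]

lemma freeRelations_freeCover : freeRelations H ≫ freeCover H = 0 := by
  refine freeModule.hom_ext fun m => ?_
  rw [NatTrans.comp_app, reassoc_of% (relι_freeRelations H), Preadditive.sub_comp, Category.assoc,
    coverι_freeCover, coverι_freeCover, ← H.map_comp, homOfLE_comp, sub_self]
  exact comp_zero.symm

/-- The component on `H_m` of a contraction of the free resolution: for `x ∈ H_m` it is the sum of
the images of `x` in `H_j` over `m ≤ j < n`. The condition in the summand holds throughout the range
of summation and only serves to form the morphisms. -/
def freeContraction (m n : ℤ) : H.obj m ⟶ (freeModule (· + 1) H.obj).obj n :=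
  ∑ j ∈ Finset.Ico m n, if h : m ≤ j ∧ j + 1 ≤ n then
    H.map (homOfLE h.1) ≫ relι H j n h.2 else 0

lemma freeContraction_self (n : ℤ) : freeContraction H n n = 0 := by
  simp [freeContraction]

lemma freeContraction_eq {m n : ℤ} (h : m + 1 ≤ n) :
    freeContraction H m n = relι H m n h +
      H.map (homOfLE (by simp : m ≤ m + 1)) ≫ freeContraction H (m + 1) n := by
  have h₀ : Finset.Ico m n = insert m (Finset.Ico (m + 1) n) := by
    ext; simp; lia
  rw [freeContraction, h₀, Finset.sum_insert (by simp), dif_pos ⟨le_rfl, h⟩, freeContraction,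
    Preadditive.comp_sum]
  congr 1
  · rw [show H.map (homOfLE le_rfl) = 𝟙 _ from H.map_id m, Category.id_comp]
  · refine Finset.sum_congr rfl fun j hj => ?_
    rw [Finset.mem_Ico] at hj
    rw [dif_pos ⟨by lia, by lia⟩, dif_pos ⟨by lia, by lia⟩, ← H.map_comp_assoc]
    rfl

lemma freeContraction_freeRelations {m n : ℤ} (h : m ≤ n) :
    freeContraction H m n ≫ (freeRelations H).app n =
      coverι H m n h - H.map (homOfLE h) ≫ coverι H n n le_rfl := by
  induction m, h using Int.leInductionDown with
  | base =>
    rw [freeContraction_self, zero_comp, show H.map (homOfLE le_rfl) = 𝟙 _ from H.map_id n,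
      Category.id_comp, sub_self]
  | pred m h ih =>
    suffices ∀ (k : ℤ) (_ : k + 1 = m) (hk : k ≤ n),
        freeContraction H k n ≫ (freeRelations H).app n =
          coverι H k n hk - H.map (homOfLE hk) ≫ coverι H n n le_rfl from this _ (by lia) _
    rintro k rfl hk
    rw [freeContraction_eq H h, Preadditive.add_comp, relι_freeRelations, Category.assoc, ih,
      Preadditive.comp_sub, ← H.map_comp_assoc, sub_add_sub_cancel, homOfLE_comp]

/-- The contraction of the free resolution. -/
def freeRetraction (n : ℤ) :
    (freeModule id H.obj).obj n ⟶ (freeModule (· + 1) H.obj).obj n :=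
  freeModule.objDesc fun m _ => freeContraction H m n

lemma coverι_freeRetraction {m n : ℤ} (h : m ≤ n) :
    coverι H m n h ≫ freeRetraction H n = freeContraction H m n :=
  freeModule.ι_objDesc (s := id) (fun m _ => freeContraction H m n) m h

lemma freeRelations_freeRetraction (n : ℤ) :
    (freeRelations H).app n ≫ freeRetraction H n = 𝟙 _ := by
  refine freeModule.obj_hom_ext fun m hm => ?_
  rw [reassoc_of% (relι_freeRelations H), Preadditive.sub_comp, Category.assoc,
    coverι_freeRetraction, coverι_freeRetraction, freeContraction_eq H hm, add_sub_cancel_right,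
    Category.comp_id]

lemma freeRetraction_add (n : ℤ) :
    freeRetraction H n ≫ (freeRelations H).app n + (freeCover H).app n ≫ coverι H n n le_rfl =
      𝟙 _ := by
  refine freeModule.obj_hom_ext fun m hm => ?_
  rw [Preadditive.comp_add, reassoc_of% (coverι_freeRetraction H), freeContraction_freeRelations,
    reassoc_of% (coverι_freeCover H), sub_add_cancel, Category.comp_id]

lemma shortExact_freeResolution :
    (ShortComplex.mk _ _ (freeRelations_freeCover H)).ShortExact := by
  have hP : JointlyReflectIsomorphisms fun n => (evaluation ℤ (ModuleCat.{u} K)).obj n :=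
    ⟨fun f h => (NatTrans.isIso_iff_isIso_app f).2 h⟩
  exact (hP.shortExact_iff _).2 fun n => ShortComplex.Splitting.shortExact
    { r := freeRetraction H n
      s := coverι H n n le_rfl
      f_r := freeRelations_freeRetraction H n
      s_g := (coverι_freeCover H le_rfl).trans (H.map_id n)
      id := freeRetraction_add H n }

end Free

/-! ### Discretized persistence dg modules are formal -/

section Discretization

open Limits HomologicalComplex

variable {K : Type u} [Field K]

/-- A functor to complexes, viewed as a complex of functors. -/
def complexOfFunctor (X : ℤ ⥤ DGMod K) : CochainComplex (ℤ ⥤ ModuleCat.{u} K) ℤ where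
  X k := X ⋙ eval _ _ k
  d i j :=
    { app := fun n => (X.obj n).d i j
      naturality := fun _ _ f => (X.map f).comm i j }
  shape i j h := by
    ext n : 2
    exact (X.obj n).shape i j h
  d_comp_d' i j k _ _ := by
    ext n : 2
    exact (X.obj n).d_comp_d i j k

/-- Viewing a functor to complexes as a complex of functors loses nothing. -/
def asFunctorComplexOfFunctor (X : ℤ ⥤ DGMod K) : (complexOfFunctor X).asFunctor ≅ X :=
  NatIso.ofComponents fun n => Hom.isoOfComponents fun k => Iso.refl _

/-- Cohomology of complexes of functors is computed objectwise. -/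
def homologyComplexOfFunctorIso (X : ℤ ⥤ DGMod K) (k : ℤ) :
    (complexOfFunctor X).homology k ≅ X ⋙ homologyFunctor (ModuleCat.{u} K) (.up ℤ) k :=
  NatIso.ofComponents
    (fun n => (((complexOfFunctor X).sc k).mapHomologyIso
      ((evaluation ℤ (ModuleCat.{u} K)).obj n)).symm)
    (fun {n n'} h => by
      have := (Iso.comp_inv_eq ((complexOfFunctor X).sc k |>.mapHomologyIso
        ((evaluation ℤ (ModuleCat.{u} K)).obj n'))).2
        ((NatTrans.app_homology ((evaluation ℤ (ModuleCat.{u} K)).map h)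
          ((complexOfFunctor X).sc k)).trans (Category.assoc _ _ _).symm)
      exact this)

lemma trivialFibration_app {J : Type} [Category.{0} J]
    {D E : CochainComplex (J ⥤ ModuleCat.{u} K) ℤ}
    (p : D ⟶ E) (hp : trivialFibration _ _ p) :
    (trivialFibration (ModuleCat.{u} K) (.up ℤ)).functorCategory J
      (complexOfFunctorsToFunctorToComplex.map p) := fun n => by
  refine ⟨?_, (quasiIso_iff_evaluation p).1 hp.2 n⟩
  have : Epi p := hp.1
  refine (MorphismProperty.epimorphisms.iff _).2 (epi_of_epi_f _ fun k => ?_)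
  have : Epi (p.f k) := inferInstance
  exact (NatTrans.epi_iff_epi_app (p.f k)).1 this n

/-- The persistence dg module with zero differential given by the cohomology of `X`. -/
def cohomologyComplex (X : PersistenceDGMod K) : PersistenceDGMod K :=
  (zeroDifferential fun k => cohomology k X).asFunctor

lemma interleaved_cohomologyComplex {ε : ℝ≥0} {X Y : PersistenceDGMod K}
    (h : ∀ k, Interleaved ε (cohomology k X) (cohomology k Y)) :
    Interleaved ε (cohomologyComplex X) (cohomologyComplex Y) := by
  choose φ ψ hφ hψ h₁ h₂ using fun k => (h k).exists_components
  refine .of_components (fun a => zeroDifferentialMap fun k => φ k a)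
    (fun a => zeroDifferentialMap fun k => ψ k a) ?_ ?_ ?_ ?_
  · intro a b h; ext k : 1; exact hφ k a b h
  · intro a b h; ext k : 1; exact hψ k a b h
  · intro a h; ext k : 1; exact h₁ k a h
  · intro a h; ext k : 1; exact h₂ k a h

/-- The grid `n ↦ δ n`. -/
def grid (δ : ℝ≥0) : ℤ ⥤ ℝ :=
  Monotone.functor (f := fun n : ℤ => (δ : ℝ) * n) fun _ _ h =>
    mul_le_mul_of_nonneg_left (by exact_mod_cast h) δ.coe_nonneg

/-- The index of the last grid point `δ n ≤ a`. For `δ = 0` the value is the junk value `0`. -/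
def gridFloor (δ : ℝ≥0) : ℝ ⥤ ℤ :=
  Monotone.functor (f := fun a : ℝ => ⌊a / δ⌋) fun _ _ h =>
    Int.floor_mono (div_le_div_of_nonneg_right h δ.coe_nonneg)

lemma interleaved_discretization {C : Type*} [Category* C] {δ : ℝ≥0} (hδ : 0 < δ) (F : ℝ ⥤ C) :
    Interleaved δ ((gridFloor δ ⋙ grid δ) ⋙ F) F := by
  have hδ' : (0 : ℝ) < δ := hδ
  refine interleaved_comp_left F _ δ (fun a => ?_) (fun a => ?_)
  · change (δ : ℝ) * ⌊a / δ⌋ ≤ a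
    have := Int.floor_le (a / δ)
    rwa [le_div_iff₀' hδ'] at this
  · change a ≤ (δ : ℝ) * ⌊a / δ⌋ + δ
    have := (Int.lt_floor_add_one (a / δ)).le
    rw [div_le_iff₀' hδ'] at this
    linarith

instance {A : Type*} [Category* A] [Abelian A] {G G' : ℤ → A} (e : ∀ k, G k ≅ G' k) :
    IsIso (zeroDifferentialMap fun k => (e k).hom) :=
  ⟨zeroDifferentialMap fun k => (e k).inv, by ext; simp, by ext; simp⟩

/-- Restricted to a grid, a persistence dg module is formal: over `ℤ` its cohomology has free
resolutions of length one. -/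
lemma spanEquivalent_discretization (δ : ℝ≥0) (X : PersistenceDGMod K) :
    SpanEquivalent (trivialFibration (ModuleCat.{u} K) (.up ℤ))
      ((gridFloor δ ⋙ grid δ) ⋙ X) ((gridFloor δ ⋙ grid δ) ⋙ cohomologyComplex X) := by
  let D := complexOfFunctor (grid δ ⋙ X)
  obtain ⟨E, p, q, hp, hq⟩ := exists_span_homology D _ _ (fun k => freeRelations (D.homology k))
    (fun k => freeCover (D.homology k)) (fun k => freeRelations_freeCover _)
    (fun k => shortExact_freeResolution _)
  let q' := q ≫ zeroDifferentialMap fun k => (homologyComplexOfFunctorIso (grid δ ⋙ X) k).hom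
  have hq' : trivialFibration _ _ q' := (MorphismProperty.cancel_right_of_respectsIso _ _ _).2 hq
  refine ⟨gridFloor δ ⋙ E.asFunctor,
    Functor.whiskerLeft (gridFloor δ) (complexOfFunctorsToFunctorToComplex.map p ≫
      (asFunctorComplexOfFunctor _).hom),
    Functor.whiskerLeft (gridFloor δ) (complexOfFunctorsToFunctorToComplex.map q'), ?_, ?_⟩
  · intro a
    exact MorphismProperty.comp_mem _ _ _ (trivialFibration_app p hp ((gridFloor δ).obj a))
      (MorphismProperty.of_isIso _ ((asFunctorComplexOfFunctor (grid δ ⋙ X)).app _).hom)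
  · exact fun a => trivialFibration_app q' hq' ((gridFloor δ).obj a)

/-- `X` is close to its discretization, which is equivalent to the discretization of the cohomology
of `X`, which in turn is close to the cohomology of `X`. -/
lemma spanInterleaved_cohomologyComplex {δ : ℝ≥0} (hδ : 0 < δ) (X : PersistenceDGMod K) :
    SpanInterleaved (trivialFibration (ModuleCat.{u} K) (.up ℤ)) (δ + δ) X
      (cohomologyComplex X) := by
  have h₁ : SpanInterleaved (trivialFibration (ModuleCat.{u} K) (.up ℤ)) δ X
      ((gridFloor δ ⋙ grid δ) ⋙ cohomologyComplex X) :=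
    ⟨X, (gridFloor δ ⋙ grid δ) ⋙ X, .refl X, (spanEquivalent_discretization δ X).symm,
      (interleaved_discretization hδ X).symm⟩
  exact h₁.trans (interleaved_discretization hδ (cohomologyComplex X)).spanInterleaved

end Discretization

/-! ### Comparison of the distances -/

section Comparison

variable {K : Type u} [Field K]

lemma HomotopyCommutativeInterleaved.cohomology {ε : ℝ≥0} {X Y : PersistenceDGMod K}
    (h : HomotopyCommutativeInterleaved (qis K) ε X Y) (k : ℤ) :
    Interleaved ε (cohomology k X) (cohomology k Y) := by
  let F := HomologicalComplex.homologyFunctor (ModuleCat.{u} K) (ComplexShape.up ℤ) k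
  have hF : (qis K).IsInvertedBy F := HomologicalComplex.homologyFunctor_inverts_quasiIso _ _ k
  let e : (qis K).Q ⋙ Localization.lift F hF (qis K).Q ≅ F := Localization.fac F hF (qis K).Q
  exact (h.map (Localization.lift F hF (qis K).Q)).of_iso (Functor.isoWhiskerLeft X e)
    (Functor.isoWhiskerLeft Y e)

lemma dCohI_le_dHC (X Y : PersistenceDGMod K) : dCohI X Y ≤ dHC X Y :=
  iSup_le fun k => infDist_mono fun _ h => h.cohomology k

lemma dHC_le_dIHC (X Y : PersistenceDGMod K) : dHC X Y ≤ dIHC X Y :=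
  infDist_mono fun _ h => h.homotopyCommutativeInterleaved

lemma dIHC_le_dHI (X Y : PersistenceDGMod K) : dIHC X Y ≤ dHI X Y :=
  infDist_mono fun _ h => h.interleavedInHo

lemma dHI_le_dCohI (X Y : PersistenceDGMod K) : dHI X Y ≤ dCohI X Y := by
  refine ENNReal.le_of_forall_pos_le_add fun η hη hfin => ?_
  lift dCohI X Y to ℝ≥0 using hfin.ne with d hd
  -- Half of `η` makes room for the infima, half for the discretizations of `X` and `Y`.
  let δ := η / 8
  have hδ : 0 < δ := by positivity
  have h (k : ℤ) : Interleaved (d + η / 2) (cohomology k X) (cohomology k Y) := by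
    have hk : interleavingDist (cohomology k X) (cohomology k Y) < (d + η / 2 : ℝ≥0) := by
      refine (le_iSup (fun k => interleavingDist (cohomology k X) (cohomology k Y)) k).trans_lt ?_
      change dCohI X Y < _
      rw [← hd]
      exact_mod_cast lt_add_of_pos_right d (by positivity)
    obtain ⟨ε, hε, h⟩ := exists_of_infDist_lt hk
    exact h.mono hε
  have hXY := ((spanInterleaved_cohomologyComplex hδ X).trans
    (interleaved_cohomologyComplex h).spanInterleaved).trans
    (spanInterleaved_cohomologyComplex hδ Y).symm
  refine (infDist_le (hXY.homotopyInterleaved (W := qis K) fun _ _ _ h => h.2)).trans ?_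
  rw [← ENNReal.coe_add, ENNReal.coe_le_coe, ← NNReal.coe_le_coe]
  simp only [δ]
  push_cast
  linarith

end Comparison

end Persistence

end

theorem mainTheorem1 (K : Type u) [Field K] (X Y : Persistence.PersistenceDGMod K) :
    Persistence.dHC X Y = Persistence.dIHC X Y ∧
    Persistence.dIHC X Y = Persistence.dHI X Y ∧
    Persistence.dHI X Y = Persistence.dCohI X Y := by
  have h₁ := Persistence.dCohI_le_dHC X Y
  have h₂ := Persistence.dHC_le_dIHC X Y
  have h₃ := Persistence.dIHC_le_dHI X Y
  have h₄ := Persistence.dHI_le_dCohI X Y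
  exact ⟨h₂.antisymm ((h₃.trans h₄).trans h₁), h₃.antisymm (h₄.trans (h₁.trans h₂)),
    h₄.antisymm (h₁.trans (h₂.trans h₃))⟩
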